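/- For a valued field $(K,v)$ write $vK$ for its value group and $Kv$ for its residue field; valuations are of arbitrary rank, and equivalent valuations are identified. An extension of valued fields $(L|K,v)$ is a field extension $L|K$ with a valuation $v$ on $L$, where $K$ carries the restriction of $v$. A valued field $(K,v)$ is called \emph{inseparably defectless} if for every finite purely inseparable extension $L|K$ equality holds in the fundamental inequality, that is, $$[L:K]=\sum_{i=1}^{g}(v_iL:vK)\,[Lv_i:Kv],$$ where $v_1,\dots,v_g$ are the distinct extensions of $v$ to $L$. An extension $(L|K,v)$ of valued fields of finite transcendence degree is said to be \emph{without transcendence defect} if $$\operatorname{trdeg} L|K=\dim_{\mathbb Q}\big((vL/vK)\otimes_{\mathbb Z}\mathbb Q\big)+\operatorname{trdeg} Lv|Kv .$$ **Proposition.** Let $(F|K,v)$ be an extension of valued fields without transcendence defect such that $F|K$ is a finitely generated field extension (possibly finite algebraic). If $(K,v)$ is inseparably defectless, then so is $(F,v)$. -/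

import Mathlib

universe u v w

open scoped TensorProduct

noncomputable section

namespace ValuedExtension

section Invariants

variable (K : Type v) {L : Type u} {Γ : Type w} [Field K] [Field L] [Algebra K L]
  [LinearOrderedCommGroupWithZero Γ] (ν : Valuation L Γ)

/-- The restriction to `K` of a valuation `ν` on an extension field `L` of `K`. -/
abbrev restrictTo : Valuation K Γ := ν.comap (algebraMap K L)

instance restrictTo_hasExtension : (restrictTo K ν).HasExtension ν where
  val_isEquiv_comap := Valuation.IsEquiv.refl

/-- The residue field `Kν` of a valued field `(K, ν)`. -/
abbrev ResField {K : Type v} [Field K] (ν : Valuation K Γ) : Type v :=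
  IsLocalRing.ResidueField ν.valuationSubring

/-- The value group `νK` of a valued field `(K, ν)`, i.e. the group of all `ν x` with `x ≠ 0`,
written multiplicatively, as a subgroup of `Γˣ`. -/
abbrev valGroup {K : Type v} [Field K] (ν : Valuation K Γ) : Subgroup Γˣ :=
  MonoidWithZeroHom.valueGroup ν.toMonoidWithZeroHom

/-- The quotient `νL / νK` of value groups (written multiplicatively) of the extension
`(L | K, ν)`, where `K` carries the restriction of `ν`. -/
abbrev ValueGroupQuotient : Type w :=
  valGroup ν ⧸ (valGroup (restrictTo K ν)).subgroupOf (valGroup ν)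

/-- The ramification index `e = (νL : νK)` of the extension `(L | K, ν)`. It is a positive
number if `L | K` is finite; the general convention for infinite index is `0`. -/
def ramificationIndex : ℕ :=
  (valGroup (restrictTo K ν)).relIndex (valGroup ν)

/-- The inertia degree `f = [Lν : Kν]` of the extension `(L | K, ν)`. It is a positive
number if `L | K` is finite; the general convention for infinite degree is `0`. -/
def inertiaDegree : ℕ :=
  Module.finrank (ResField (restrictTo K ν)) (ResField ν)

/-- The rational rank `dim_ℚ ((νL / νK) ⊗ ℚ)` of `νL / νK`, as a cardinal. -/
def rationalRank : Cardinal.{w} :=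
  Module.rank ℚ (ℚ ⊗[ℤ] Additive (ValueGroupQuotient K ν))

/-- The transcendence degree of the residue field extension `Lν | Kν`, as a cardinal. -/
def residueTrdeg : Cardinal.{u} :=
  Algebra.trdeg (ResField (restrictTo K ν)) (ResField ν)

/-- `(L | K, ν)` is without transcendence defect: `L | K` has finite transcendence degree and
`trdeg L | K = rr (νL / νK) + trdeg (Lν | Kν)`. -/
def WithoutTranscendenceDefect : Prop :=
  Algebra.trdeg K L < Cardinal.aleph0 ∧
    Cardinal.lift.{w} (Algebra.trdeg K L) =
      Cardinal.lift.{u} (rationalRank K ν) + Cardinal.lift.{w} (residueTrdeg K ν)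

variable (L) in
/-- `L | K` is an (algebraic) function field: a finitely generated field extension, finite
algebraic extensions being included. -/
def IsFunctionField : Prop := (⊤ : IntermediateField K L).FG

end Invariants

section Defect

variable {K : Type u} {Γ : Type w} [Field K] [LinearOrderedCommGroupWithZero Γ]

/-- The extensions of the valuation `ν` of `K` to the extension field `L`. Equivalent valuations
are identified, so an extension is given by its valuation ring, a valuation ring of `L` lying
above the one of `ν`. -/
def Extensions (ν : Valuation K Γ) (L : Type v) [Field L] [Algebra K L] :
    Set (ValuationSubring L) :=
  {B | B.comap (algebraMap K L) = ν.valuationSubring}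

/-- `(K, ν)` is defectless in the finite extension `L`: equality `[L : K] = ∑ eᵢ fᵢ` holds in the
fundamental inequality, the sum being taken over the (finitely many) extensions of `ν` to `L`. -/
def IsDefectlessIn (ν : Valuation K Γ) (L : Type v) [Field L] [Algebra K L] : Prop :=
  Module.finrank K L =
    ∑ᶠ B ∈ Extensions ν L, ramificationIndex K B.valuation * inertiaDegree K B.valuation

/-- `(K, ν)` is an inseparably defectless field: it is defectless in every finite purely
inseparable extension. -/
def IsInseparablyDefectless (ν : Valuation K Γ) : Prop :=
  ∀ (L : Type u) [Field L] [Algebra K L] [FiniteDimensional K L] [IsPurelyInseparable K L],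
    IsDefectlessIn ν L

end Defect

end ValuedExtension

end

/-!
Let `q` be a power of the characteristic exponent. Applying the `q`-th power map, a finite purely
inseparable extension `L` of `F` with `L ^ q ⊆ F` becomes a subfield `M` of `F` that is finite over
`F ^ q`, so that everything takes place among subfields of the one valued field `F`.

The basic notion is a *valuation-independent* family (`VIndep`): the value of every linear
combination is the maximum of the values of its terms. In a finite extension `M | N`, the largest
size of such a family of nonzero elements is exactly `e * f` (`exists_vIndep`, `VIndep.card_le`);
this gives `e * f ≤ [M : N]` and the invariance of `e * f` under the power map (`efProduct_map`).
The property that is carried from `K` to `F` is `FrobeniusDefectless N`: every finite subset of `N`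
lies in some finite extension `M | N ^ q` inside `N` with `[M : N ^ q] = e * f`.

* Since there is no transcendence defect, `F | K` has a transcendence basis `t` consisting of
  elements with values rationally independent modulo the value group of `K` and elements with
  residues algebraically independent over that of `K`. The monomials in `t` are
  valuation-independent over `K` (`vIndep_monomialAt_sumElim`). Hence, if `b` is a valuation basis
  of `M | K ^ q`, the products of the `b i` with the monomials of exponents below `q` form a
  valuation basis of `M(t) | K(t) ^ q` (`FrobeniusDefectless.closure_range`).
* The remaining generators are algebraic. For a simple algebraic extension `F = E(b)` and a large
  enough finite extension `M` of `E ^ q` inside `E`, put `F₀ = M(b)`. Degrees and the products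
  `e * f` in the towers `E ^ q ⊆ M ⊆ F₀` and `E ^ q ⊆ F ^ q ⊆ F₀` are compared, using that
  `F ^ q | E ^ q` is isomorphic to `F | E`; a possible defect of `F | E` cancels
  (`FrobeniusDefectless.closure_singleton`).
* Defectlessness of `F₀ | F ^ q` passes to the intermediate fields `M`, as both the degree and
  `e * f` are multiplicative (`isInseparablyDefectless_of_frobeniusDefectless`).
-/

namespace ValuedExtension

/-! ### Valuation-independent families -/

section ValuationIndependence

variable {L : Type*} {Γ : Type*} [Field L] [LinearOrderedCommGroupWithZero Γ]
  {ν : Valuation L Γ} {ι κ : Type*}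

/-- The family `b` is valuation-independent with respect to a set `C` of coefficients: no term of a
linear combination `∑ c i * b i` with coefficients in `C` has a larger value than the sum, so that
the value of the sum is the maximum of the values of its terms. The coefficients may form an
arbitrary set, since rings such as `N[t]` and sets such as `{x | ν x ∈ ν N}` occur besides
subfields. -/
def VIndep (ν : Valuation L Γ) (C : Set L) (b : ι → L) : Prop :=
  ∀ (s : Finset ι) (c : ι → L), (∀ i ∈ s, c i ∈ C) →
    ∀ i ∈ s, ν (c i * b i) ≤ ν (∑ j ∈ s, c j * b j)

lemma VIndep.mono {C D : Set L} {b : ι → L} (h : VIndep ν D b) (hCD : C ⊆ D) : VIndep ν C b :=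
  fun s c hc => h s c fun i hi => hCD (hc i hi)

lemma VIndep.comp {C : Set L} {b : ι → L} (h : VIndep ν C b) {f : κ → ι}
    (hf : Function.Injective f) : VIndep ν C (b ∘ f) := by
  classical
  intro s c hc i hi
  cases isEmpty_or_nonempty κ with
  | inl h => exact (h.false i).elim
  | inr _ =>
    have key : ∀ k, c (Function.invFun f (f k)) = c k := fun k => by
      simp [Function.leftInverse_invFun hf k]
    have := h (s.map ⟨f, hf⟩) (fun j => c (Function.invFun f j)) (by
      intro j hj
      obtain ⟨k, hk, rfl⟩ := Finset.mem_map.1 hj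
      simpa only [Function.Embedding.coeFn_mk, key] using hc k hk) (f i)
      (Finset.mem_map_of_mem ⟨f, hf⟩ hi)
    simpa only [Finset.sum_map, Function.Embedding.coeFn_mk, key, Function.comp_apply] using this

/-- The value of a linear combination of a valuation-independent family is attained. -/
lemma VIndep.exists_eq {C : Set L} {b : ι → L} (h : VIndep ν C b) {s : Finset ι}
    (hs : s.Nonempty) {c : ι → L} (hc : ∀ i ∈ s, c i ∈ C) :
    ∃ i ∈ s, ν (∑ j ∈ s, c j * b j) = ν (c i * b i) := by
  obtain ⟨i, hi, hmax⟩ := s.exists_max_image (fun i => ν (c i * b i)) hs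
  exact ⟨i, hi, le_antisymm (Valuation.map_sum_le ν hmax) (h s c hc i hi)⟩

lemma VIndep.linearIndependent {N : Subfield L} {b : ι → L} (h : VIndep ν N b)
    (hb : ∀ i, b i ≠ 0) : LinearIndependent N b := by
  rw [linearIndependent_iff']
  intro s g hg i hi
  have := h s (fun i => g i) (fun i _ => (g i).2) i hi
  have h0 : ∑ j ∈ s, (g j : L) * b j = 0 := by simpa [Subfield.smul_def] using hg
  rw [h0, map_zero, le_zero_iff, map_eq_zero, mul_eq_zero] at this
  exact Subtype.ext (this.resolve_right (hb i))

/-- Transitivity: if `a` is valuation-independent over a set containing all linear combinations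
of the family `u`, then the products form a valuation-independent family. -/
lemma VIndep.mul {C D : Set L} {a : κ → L} {u : ι → L} (ha : VIndep ν D a) (hu : VIndep ν C u)
    (hD : ∀ (s : Finset ι) (c : ι → L), (∀ i ∈ s, c i ∈ C) → ∑ j ∈ s, c j * u j ∈ D) :
    VIndep ν C (fun k : κ × ι => a k.1 * u k.2) := by
  classical
  intro s c hc k hk
  let t : κ → Finset ι := fun x => (s.filter fun y => y.1 = x).image Prod.snd
  have mem_t : ∀ x i, i ∈ t x ↔ (x, i) ∈ s := by
    intro x i
    simp only [t, Finset.mem_image, Finset.mem_filter, Prod.exists]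
    constructor
    · rintro ⟨a, b, ⟨h, rfl⟩, rfl⟩; exact h
    · intro h; exact ⟨x, i, ⟨h, rfl⟩, rfl⟩
  have hct : ∀ x, ∀ i ∈ t x, c (x, i) ∈ C := fun x i hi => hc _ ((mem_t x i).1 hi)
  have hsum : ∑ y ∈ s, c y * (a y.1 * u y.2)
      = ∑ x ∈ s.image Prod.fst, (∑ i ∈ t x, c (x, i) * u i) * a x := by
    rw [Finset.sum_finset_product s (s.image Prod.fst) t fun y => ⟨fun h =>
      ⟨Finset.mem_image_of_mem _ h, (mem_t _ _).2 h⟩, fun h => (mem_t _ _).1 h.2⟩]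
    refine Finset.sum_congr rfl fun x _ => ?_
    rw [Finset.sum_mul]
    exact Finset.sum_congr rfl fun i _ => by ring
  rw [hsum]
  refine le_trans ?_ (ha (s.image Prod.fst) (fun x => ∑ i ∈ t x, c (x, i) * u i)
    (fun x _ => hD _ _ (hct x)) k.1 (Finset.mem_image_of_mem _ hk))
  have := hu (t k.1) (fun i => c (k.1, i)) (hct k.1) k.2 ((mem_t _ _).2 hk)
  rw [map_mul, map_mul ν _ (a k.1), map_mul]
  rw [map_mul] at this
  calc ν (c k) * (ν (a k.1) * ν (u k.2)) = ν (c k) * ν (u k.2) * ν (a k.1) := by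
        rw [mul_assoc, mul_comm (ν (a k.1))]
    _ ≤ _ := mul_le_mul_left this _

/-- A product family that is valuation-independent over `C` yields valuation independence of one
factor over the linear combinations of the other one. -/
lemma VIndep.of_mul {C D : Set L} (hC : (0 : L) ∈ C) {a : κ → L} {u : ι → L}
    (h : VIndep ν C (fun k : κ × ι => a k.1 * u k.2))
    (hD : ∀ x ∈ D, ∃ (s : Finset ι) (c : ι → L), (∀ i, c i ∈ C) ∧ x = ∑ j ∈ s, c j * u j) :
    VIndep ν D a := by
  classical
  intro s c hc k hk
  choose! t d hd hcd using hD
  let T : Finset ι := s.biUnion fun k => t (c k)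
  let e : κ × ι → L := fun k => if k.2 ∈ t (c k.1) then d (c k.1) k.2 else 0
  have hsum : ∀ k ∈ s, c k = ∑ i ∈ T, e (k, i) * u i := by
    intro k hk
    nth_rw 1 [hcd (c k) (hc k hk)]
    simp only [e, ite_mul, zero_mul]
    rw [← Finset.sum_filter]
    refine Finset.sum_congr ?_ fun _ _ => rfl
    ext i
    simp only [T, Finset.mem_filter, Finset.mem_biUnion]
    exact ⟨fun h => ⟨⟨k, hk, h⟩, h⟩, fun h => h.2⟩
  have hs : ∑ k ∈ s, c k * a k = ∑ x ∈ s ×ˢ T, e x * (a x.1 * u x.2) := by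
    rw [Finset.sum_product]
    refine Finset.sum_congr rfl fun k hk => ?_
    rw [hsum k hk, Finset.sum_mul]
    exact Finset.sum_congr rfl fun i _ => by ring
  rw [hs, hsum k hk, Finset.sum_mul]
  refine Valuation.map_sum_le ν fun i hi => ?_
  have := h (s ×ˢ T) e (fun x hx => ?_) (k, i) (Finset.mem_product.2 ⟨hk, hi⟩)
  · rw [show e (k, i) * u i * a k = e (k, i) * (a k * u i) by ring]; exact this
  · simp only [e]; split_ifs
    · exact hd _ (hc _ (Finset.mem_product.1 hx).1) _
    · exact hC

/-- Valuation independence over a domain passes to its field of fractions. -/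
lemma VIndep.of_div {R : Subring L} {a : κ → L} (h : VIndep ν R a) {D : Set L}
    (hD : ∀ x ∈ D, ∃ n ∈ R, ∃ d ∈ R, x = n / d) : VIndep ν D a := by
  classical
  intro s c hc k hk
  have hD' : ∀ x ∈ D, ∃ d ∈ R, d ≠ 0 ∧ d * x ∈ R := by
    intro x hx
    obtain ⟨n, hn, d, hd, rfl⟩ := hD x hx
    by_cases h0 : d = 0
    · exact ⟨1, R.one_mem, one_ne_zero, by simp [h0]⟩
    · exact ⟨d, hd, h0, by rwa [mul_div_cancel₀ _ h0]⟩
  choose! d hd hd0 hdx using hD'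
  set P := ∏ k ∈ s, d (c k) with hP
  have hP0 : P ≠ 0 := Finset.prod_ne_zero_iff.2 fun k hk => hd0 _ (hc k hk)
  have := h s (fun k => P * c k) (fun i hi => by
    rw [hP, ← Finset.mul_prod_erase s _ hi, mul_right_comm]
    exact R.mul_mem (hdx _ (hc i hi))
      (R.prod_mem fun j hj => hd _ (hc j (Finset.mem_of_mem_erase hj)))) k hk
  simp only [mul_assoc, ← Finset.mul_sum] at this
  rw [map_mul, map_mul ν P] at this
  exact le_of_mul_le_mul_left this (zero_lt_iff.2 ((map_ne_zero ν).2 hP0))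

/-- Elements whose values lie in pairwise distinct cosets are valuation-independent. -/
lemma VIndep.of_ne {C : Set L} {a : κ → L}
    (h : ∀ k k', k ≠ k' → ∀ c ∈ C, ∀ c' ∈ C, ν (c * a k) ≠ 0 → ν (c * a k) ≠ ν (c' * a k')) :
    VIndep ν C a := by
  classical
  intro s c hc k hk
  obtain ⟨m, hm, hmax⟩ := s.exists_max_image (fun i => ν (c i * a i)) ⟨k, hk⟩
  refine (hmax k hk).trans ?_
  by_cases h0 : ν (c m * a m) = 0
  · rw [h0]; exact zero_le
  rw [← Finset.add_sum_erase s _ hm, Valuation.map_add_eq_of_lt_left]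
  refine Valuation.map_sum_lt ν h0 fun i hi => ?_
  have hi' := Finset.mem_of_mem_erase hi
  exact lt_of_le_of_ne (hmax i hi')
    (h m i (Finset.ne_of_mem_erase hi).symm _ (hc m hm) _ (hc i hi') h0).symm

end ValuationIndependence

/-! ### Value groups and residue fields of subfields -/

section Invariants

variable {L : Type*} {Γ : Type*} [Field L] [LinearOrderedCommGroupWithZero Γ]
  (ν : Valuation L Γ) {ι κ : Type*}

/-- The value group of a subfield `N` of the valued field `(L, ν)`, as a subgroup of `Γˣ`. -/
def valGroupOf (N : Subfield L) : Subgroup Γˣ where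
  carrier := {g | ∃ x ∈ N, ν x = g}
  one_mem' := ⟨1, N.one_mem, by simp⟩
  mul_mem' := by
    rintro a b ⟨x, hx, hxa⟩ ⟨y, hy, hyb⟩
    exact ⟨x * y, N.mul_mem hx hy, by simp [hxa, hyb]⟩
  inv_mem' := by
    rintro a ⟨x, hx, hxa⟩
    exact ⟨x⁻¹, N.inv_mem hx, by simp [hxa]⟩

/-- The residue field of a subfield `N` of `(L, ν)`, as a subfield of the residue field of `L`. -/
def resFieldOf (N : Subfield L) : Subfield (ResField ν) where
  carrier := {a | ∃ x : ν.valuationSubring, (x : L) ∈ N ∧ IsLocalRing.residue _ x = a}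
  one_mem' := ⟨1, N.one_mem, map_one _⟩
  zero_mem' := ⟨0, N.zero_mem, map_zero _⟩
  mul_mem' := by
    rintro a b ⟨x, hx, rfl⟩ ⟨y, hy, rfl⟩
    exact ⟨x * y, N.mul_mem hx hy, map_mul _ _ _⟩
  add_mem' := by
    rintro a b ⟨x, hx, rfl⟩ ⟨y, hy, rfl⟩
    exact ⟨x + y, N.add_mem hx hy, map_add _ _ _⟩
  neg_mem' := by
    rintro a ⟨x, hx, rfl⟩
    exact ⟨-x, N.neg_mem hx, map_neg _ _⟩
  inv_mem' := by
    rintro a ⟨x, hx, rfl⟩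
    by_cases h : IsUnit x
    · obtain ⟨u, rfl⟩ := h
      refine ⟨(u⁻¹ : _ˣ), ?_, ?_⟩
      · have : ((u⁻¹ : (ν.valuationSubring)ˣ) : L) = ((u : ν.valuationSubring) : L)⁻¹ := by
          refine eq_inv_of_mul_eq_one_left ?_
          rw [← MulMemClass.coe_mul, Units.inv_mul, OneMemClass.coe_one]
        simpa only [this] using N.inv_mem hx
      · refine eq_inv_of_mul_eq_one_left ?_
        rw [← map_mul, Units.inv_mul, map_one]
    · refine ⟨0, N.zero_mem, ?_⟩
      rw [(IsLocalRing.residue_eq_zero_iff x).2 h, inv_zero, map_zero]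

lemma residue_eq_zero_iff (x : ν.valuationSubring) :
    IsLocalRing.residue ν.valuationSubring x = 0 ↔ ν (x : L) < 1 := by
  rw [IsLocalRing.residue_eq_zero_iff, ValuationSubring.valuation_lt_one_iff]
  exact (Valuation.isEquiv_valuation_valuationSubring ν).symm.lt_one_iff_lt_one

variable {ν}

lemma valGroupOf_mono {N M : Subfield L} (h : N ≤ M) : valGroupOf ν N ≤ valGroupOf ν M :=
  fun _ ⟨x, hx, e⟩ => ⟨x, h hx, e⟩

lemma resFieldOf_mono {N M : Subfield L} (h : N ≤ M) : resFieldOf ν N ≤ resFieldOf ν M :=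
  fun _ ⟨x, hx, e⟩ => ⟨x, h hx, e⟩

/-- Integral elements whose residues are linearly independent are valuation-independent. -/
lemma VIndep.of_residue {N : Subfield L} {u : ι → ν.valuationSubring}
    (hu : LinearIndependent (resFieldOf ν N) fun i => IsLocalRing.residue ν.valuationSubring (u i)) :
    VIndep ν N fun i => (u i : L) := by
  classical
  intro s c hc i hi
  obtain ⟨m, hm, hmax⟩ := s.exists_max_image (fun i => ν (c i)) ⟨i, hi⟩
  have hle : ν (c i * u i) ≤ ν (c m) := by
    rw [map_mul]
    exact (mul_le_of_le_one_right' (u i).2).trans (hmax i hi)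
  refine hle.trans ?_
  by_cases h0 : c m = 0
  · simp [h0]
  have h0' : ν (c m) ≠ 0 := (map_ne_zero ν).2 h0
  -- after division by a coefficient of maximal value, the coefficient at `m` becomes `1`
  have hd : ∀ j, j ∈ s → c j / c m ∈ ν.valuationSubring := fun j hj => by
    rw [Valuation.mem_valuationSubring_iff, map_div₀]
    exact div_le_one_of_le₀ (hmax j hj) zero_le
  let d : ι → ν.valuationSubring := fun j => if h : j ∈ s then ⟨c j / c m, hd j h⟩ else 0
  have hdj : ∀ j ∈ s, (d j : L) = c j / c m := fun j hj => by simp [d, hj]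
  have hres : IsLocalRing.residue ν.valuationSubring (∑ j ∈ s, d j * u j) ≠ 0 := by
    intro h
    rw [map_sum] at h
    have := linearIndependent_iff'.1 hu s (fun j => if h : j ∈ s then
      ⟨IsLocalRing.residue _ (d j), d j, by
        rw [hdj j h]; exact N.div_mem (hc j h) (hc m hm), rfl⟩ else 0) (by
        rw [← h]
        refine Finset.sum_congr rfl fun j hj => ?_
        simp [hj, Subfield.smul_def]) m hm
    simp only [hm, dite_true] at this
    have h1 : d m = 1 := Subtype.ext (by rw [hdj m hm, div_self h0]; rfl)
    have h2 := congrArg Subtype.val this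
    simp [h1] at h2
  rw [Ne, residue_eq_zero_iff, not_lt] at hres
  have hsum : ((∑ j ∈ s, d j * u j : ν.valuationSubring) : L) = (∑ j ∈ s, c j * u j) / c m := by
    push_cast
    rw [Finset.sum_div]
    exact Finset.sum_congr rfl fun j hj => by rw [hdj j hj]; ring
  rw [hsum, map_div₀] at hres
  exact (one_le_div₀ (zero_lt_iff.2 h0')).1 hres

/-- Representatives of distinct value cosets times integral lifts of residues linearly independent
over the smaller residue field form a valuation-independent family. -/
lemma VIndep.mul_of_residue {N : Subfield L} {a : κ → L} {u : ι → ν.valuationSubring}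
    (ha : ∀ k k', k ≠ k' → ∀ c ∈ N, ∀ c' ∈ N, ν (c * a k) ≠ 0 → ν (c * a k) ≠ ν (c' * a k'))
    (hu : LinearIndependent (resFieldOf ν N) fun i => IsLocalRing.residue ν.valuationSubring (u i)) :
    VIndep ν N fun k : κ × ι => a k.1 * (u k.2 : L) := by
  have hu' := VIndep.of_residue hu
  have h1 : ∀ i, ν (u i : L) = 1 := fun i => by
    refine le_antisymm (u i).2 ?_
    have := hu.ne_zero i
    rwa [Ne, residue_eq_zero_iff, not_lt] at this
  refine VIndep.mul (D := {x | ∃ c ∈ N, ν x = ν c}) (VIndep.of_ne ?_) hu' ?_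
  · rintro k k' hk c ⟨d, hd, hcd⟩ c' ⟨d', hd', hcd'⟩
    rw [map_mul, map_mul, hcd, hcd', ← map_mul, ← map_mul]
    exact ha k k' hk d hd d' hd'
  · intro s c hc
    rcases s.eq_empty_or_nonempty with rfl | hs
    · exact ⟨0, N.zero_mem, by simp⟩
    · obtain ⟨i, hi, h⟩ := hu'.exists_eq hs hc
      exact ⟨c i, hc i hi, by rw [h, map_mul, h1, mul_one]⟩

variable (ν) in
/-- The product `e * f` of ramification index and inertia degree of subfields `N ≤ M`. -/
noncomputable def efProduct (N M : Subfield L) : ℕ :=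
  (valGroupOf ν N).relIndex (valGroupOf ν M) * (resFieldOf ν N).relfinrank (resFieldOf ν M)

lemma efProduct_mul_efProduct {N M P : Subfield L} (h : N ≤ M) (h' : M ≤ P) :
    efProduct ν N M * efProduct ν M P = efProduct ν N P := by
  rw [efProduct, efProduct, efProduct, mul_mul_mul_comm,
    Subgroup.relIndex_mul_relIndex _ _ _ (valGroupOf_mono h) (valGroupOf_mono h'),
    Subfield.relfinrank_mul_relfinrank (resFieldOf_mono h) (resFieldOf_mono h')]

lemma card_le_relfinrank {N M : Subfield L} (h : N ≤ M) (h0 : N.relfinrank M ≠ 0) [Fintype ι]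
    {b : ι → L} (hb : LinearIndependent N b) (hM : ∀ i, b i ∈ M) :
    Fintype.card ι ≤ N.relfinrank M := by
  rw [Subfield.relfinrank_eq_finrank_of_le h] at h0 ⊢
  have := Module.finite_of_finrank_pos (Nat.pos_of_ne_zero h0)
  let b' : ι → Subfield.extendScalars h := fun i => ⟨b i, hM i⟩
  have : LinearIndependent N b' :=
    LinearIndependent.of_comp (Subfield.extendScalars h).val.toLinearMap hb
  exact this.fintype_card_le_finrank

lemma finite_of_linearIndependent {N M : Subfield L} (h : N ≤ M) (h0 : N.relfinrank M ≠ 0)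
    {b : ι → L} (hb : LinearIndependent N b) (hM : ∀ i, b i ∈ M) : Finite ι := by
  rw [Subfield.relfinrank_eq_finrank_of_le h] at h0
  have := Module.finite_of_finrank_pos (Nat.pos_of_ne_zero h0)
  let b' : ι → Subfield.extendScalars h := fun i => ⟨b i, hM i⟩
  have : LinearIndependent N b' :=
    LinearIndependent.of_comp (Subfield.extendScalars h).val.toLinearMap hb
  exact this.finite

/-- A finite extension `M | N` of subfields has finite ramification index and inertia degree, and a
valuation-independent family of `e * f` elements, namely the products of representatives of the
value cosets and lifts of a basis of the residue field extension. -/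
lemma exists_vIndep {N M : Subfield L} (h : N ≤ M) (h0 : N.relfinrank M ≠ 0) :
    (valGroupOf ν N).relIndex (valGroupOf ν M) ≠ 0 ∧
    (resFieldOf ν N).relfinrank (resFieldOf ν M) ≠ 0 ∧
    ∃ b : Fin (efProduct ν N M) → L, (∀ i, b i ∈ M) ∧ (∀ i, b i ≠ 0) ∧ VIndep ν N b := by
  classical
  let Q := valGroupOf ν M ⧸ (valGroupOf ν N).subgroupOf (valGroupOf ν M)
  have hQ : ∀ k : Q, ∃ x ∈ M, ν x = (k.out : Γˣ) := fun k => k.out.2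
  choose a haM ha using hQ
  let R := Subfield.extendScalars (resFieldOf_mono (ν := ν) h)
  let I := Module.Basis.ofVectorSpaceIndex (resFieldOf ν N) R
  let B : Module.Basis I (resFieldOf ν N) R := Module.Basis.ofVectorSpace (resFieldOf ν N) R
  have hB : ∀ i, ∃ x : ν.valuationSubring, (x : L) ∈ M ∧
      IsLocalRing.residue _ x = (B i : ResField ν) := fun i => (B i).2
  choose u huM hu using hB
  have hlin : LinearIndependent (resFieldOf ν N) fun i =>
      IsLocalRing.residue ν.valuationSubring (u i) := by
    simp only [hu]
    exact B.linearIndependent.map' (Subfield.extendScalars (resFieldOf_mono h)).val.toLinearMap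
      (LinearMap.ker_eq_bot.2 Subtype.val_injective)
  have ha0 : ∀ k, a k ≠ 0 := fun k hk => by
    have := ha k
    rw [hk, map_zero] at this
    exact (Units.ne_zero _) this.symm
  have hu0 : ∀ i, (u i : L) ≠ 0 := fun i hi => by
    have h1 : u i = 0 := Subtype.ext hi
    exact hlin.ne_zero i (by simp only [h1, map_zero])
  have hind := VIndep.mul_of_residue (N := N) (a := a) (u := u) (by
    intro k k' hk c hc c' hc' hne heq
    refine hk ?_
    rw [← k.out_eq', ← k'.out_eq']
    refine QuotientGroup.eq.2 ?_
    rw [Subgroup.mem_subgroupOf]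
    have hc0 : c' ≠ 0 := by rintro rfl; rw [heq, zero_mul, map_zero] at hne; exact hne rfl
    refine ⟨c / c', N.div_mem hc hc', ?_⟩
    rw [map_mul, map_mul, ha, ha] at heq
    have hc0' : ν c' ≠ 0 := (map_ne_zero ν).2 hc0
    rw [map_div₀]
    simp only [Subgroup.coe_mul, Subgroup.coe_inv, Units.val_mul, Units.val_inv_eq_inv_val]
    rw [div_eq_iff hc0', eq_comm, inv_mul_eq_div, div_mul_eq_mul_div,
      div_eq_iff (Units.ne_zero _), heq, mul_comm]) hlin
  have hfin : Finite (Q × I) := finite_of_linearIndependent h h0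
    (hind.linearIndependent fun i => mul_ne_zero (ha0 _) (hu0 _))
    fun i => M.mul_mem (haM _) (huM _)
  have : Nonempty I := B.index_nonempty
  have : Finite Q := Finite.prod_left I
  have : Finite I := Finite.prod_right Q
  have hrank : (resFieldOf ν N).relfinrank (resFieldOf ν M) = Nat.card I := by
    rw [Subfield.relfinrank_eq_finrank_of_le (resFieldOf_mono h), Module.finrank_eq_nat_card_basis B]
  have hcard : Nat.card (Q × I) = efProduct ν N M := by
    rw [Nat.card_prod, efProduct, hrank]; rfl
  refine ⟨?_, ?_, ?_⟩
  · exact Nat.card_pos.ne'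
  · rw [hrank]; exact Nat.card_pos.ne'
  · let e := (Finite.equivFinOfCardEq hcard).symm
    exact ⟨_, fun i => M.mul_mem (haM _) (huM _), fun i => mul_ne_zero (ha0 _) (hu0 _),
      hind.comp e.injective⟩

lemma efProduct_ne_zero {N M : Subfield L} (h : N ≤ M) (h0 : N.relfinrank M ≠ 0) :
    efProduct ν N M ≠ 0 :=
  mul_ne_zero (exists_vIndep h h0).1 (exists_vIndep h h0).2.1

/-- The fundamental inequality `e * f ≤ [M : N]`. -/
lemma efProduct_le_relfinrank {N M : Subfield L} (h : N ≤ M) (h0 : N.relfinrank M ≠ 0) :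
    efProduct ν N M ≤ N.relfinrank M := by
  obtain ⟨b, hM, hb0, hb⟩ := (exists_vIndep (ν := ν) h h0).2.2
  simpa using card_le_relfinrank h h0 (hb.linearIndependent hb0) hM

/-- A valuation-independent family in a finite extension `M | N` has at most `e * f` elements:
the elements are sorted by the cosets of their values, and those in one coset have, after scaling,
residues that are linearly independent. -/
lemma VIndep.card_le {N M : Subfield L} (h : N ≤ M) (h0 : N.relfinrank M ≠ 0) [Fintype ι]
    {b : ι → L} (hb : VIndep ν N b) (hM : ∀ i, b i ∈ M) (hb0 : ∀ i, b i ≠ 0) :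
    Fintype.card ι ≤ efProduct ν N M := by
  classical
  obtain ⟨hQ0, hR0, -⟩ := exists_vIndep (ν := ν) h h0
  let Q := valGroupOf ν M ⧸ (valGroupOf ν N).subgroupOf (valGroupOf ν M)
  have : Finite Q := (Nat.card_ne_zero.1 hQ0).2
  have := Fintype.ofFinite Q
  let g : ι → valGroupOf ν M := fun i =>
    ⟨Units.mk0 (ν (b i)) ((map_ne_zero ν).2 (hb0 i)), b i, hM i, rfl⟩
  let π : ι → Q := fun i => QuotientGroup.mk (g i)
  have hfib : ∀ q ∈ Finset.univ.image π, (Finset.univ.filter fun i => π i = q).card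
      ≤ (resFieldOf ν N).relfinrank (resFieldOf ν M) := by
    intro q hq
    obtain ⟨m, -, rfl⟩ := Finset.mem_image.1 hq
    have hn : ∀ i : {i // π i = π m}, ∃ n ∈ N, ν (n * b i) = ν (b m) := by
      rintro ⟨i, hi⟩
      obtain ⟨n, hn, hv⟩ := Subgroup.mem_subgroupOf.1 (QuotientGroup.eq.1 hi)
      refine ⟨n, hn, ?_⟩
      have hv' : ν n = (ν (b i))⁻¹ * ν (b m) := hv.trans (by
        simp only [Subgroup.coe_mul, Subgroup.coe_inv, Units.val_mul,
          Units.val_inv_eq_inv_val, g, Units.val_mk0])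
      rw [map_mul, hv', mul_right_comm, inv_mul_cancel₀ ((map_ne_zero ν).2 (hb0 i)), one_mul]
    choose n hnN hnv using hn
    have hm0 : ν (b m) ≠ 0 := (map_ne_zero ν).2 (hb0 m)
    let w : {i // π i = π m} → ν.valuationSubring := fun i =>
      ⟨n i * b i / b m, by rw [Valuation.mem_valuationSubring_iff, map_div₀, hnv, div_self hm0]⟩
    have hw : LinearIndependent (resFieldOf ν N) fun i =>
        IsLocalRing.residue ν.valuationSubring (w i) := by
      rw [linearIndependent_iff']
      intro s r hr i hi
      choose x hxN hx using fun i => (r i).2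
      have hr' : IsLocalRing.residue ν.valuationSubring (∑ j ∈ s, x j * w j) = 0 := by
        rw [← hr, map_sum]
        exact Finset.sum_congr rfl fun j _ => by rw [map_mul, hx]; rfl
      rw [residue_eq_zero_iff] at hr'
      have hsum : ((∑ j ∈ s, x j * w j : ν.valuationSubring) : L)
          = (∑ j ∈ s, (x j * n j) * b j) / b m := by
        push_cast
        rw [Finset.sum_div]
        exact Finset.sum_congr rfl fun j _ => by simp only [w]; ring
      rw [hsum, map_div₀, div_lt_one₀ (zero_lt_iff.2 hm0)] at hr'
      have := (hb.comp (Subtype.val_injective (p := fun i => π i = π m))) s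
        (fun j => x j * n j) (fun j _ => N.mul_mem (hxN j) (hnN j)) i hi
      have hlt := this.trans_lt hr'
      rw [Function.comp_apply, mul_assoc, map_mul, hnv] at hlt
      have : ν (x i : L) < 1 := by
        by_contra hcon
        exact absurd hlt (not_lt.2 (le_mul_of_one_le_left' (not_lt.1 hcon)))
      refine Subtype.ext ?_
      rw [← hx, (residue_eq_zero_iff ν _).2 this]; rfl
    have := card_le_relfinrank (resFieldOf_mono h) hR0 hw fun i =>
      ⟨w i, M.div_mem (M.mul_mem (h (hnN i)) (hM i)) (hM m), rfl⟩
    rwa [Fintype.card_subtype] at this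
  have h1 := Finset.card_le_mul_card_image (f := π) Finset.univ _ hfib
  have h2 : (Finset.univ.image π).card ≤ (valGroupOf ν N).relIndex (valGroupOf ν M) := by
    refine (Finset.card_le_univ _).trans ?_
    rw [← Nat.card_eq_fintype_card]; exact le_of_eq rfl
  rw [Finset.card_univ] at h1
  refine h1.trans ?_
  rw [efProduct, mul_comm]
  exact Nat.mul_le_mul_right _ h2

end Invariants

/-! ### Comparison along embeddings -/

section Transfer

variable {L L' Γ Γ' ι : Type*} [Field L] [Field L'] [LinearOrderedCommGroupWithZero Γ]
  [LinearOrderedCommGroupWithZero Γ'] {ν : Valuation L Γ} {ν' : Valuation L' Γ'} {ψ : L →+* L'}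

lemma vIndep_map_iff (h : ∀ x y, ν x ≤ ν y ↔ ν' (ψ x) ≤ ν' (ψ y)) {N : Subfield L} {b : ι → L} :
    VIndep ν' (N.map ψ) (ψ ∘ b) ↔ VIndep ν N b := by
  constructor
  · intro H s c hc i hi
    have := H s (ψ ∘ c) (fun i hi => ⟨c i, hc i hi, rfl⟩) i hi
    rw [h]
    simpa using this
  · intro H s c hc i hi
    choose! d hdN hd using hc
    have := H s d hdN i hi
    rw [h, map_mul, hd i hi, map_sum] at this
    refine this.trans_eq (congrArg _ (Finset.sum_congr rfl fun j hj => ?_))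
    rw [map_mul, hd j hj]; rfl

/-- The number `e * f` is the maximal size of a valuation-independent family, so it is preserved by
embeddings that respect the orderings given by the valuations. -/
lemma efProduct_map (h : ∀ x y, ν x ≤ ν y ↔ ν' (ψ x) ≤ ν' (ψ y)) {N M : Subfield L}
    (hNM : N ≤ M) (h0 : N.relfinrank M ≠ 0) : efProduct ν' (N.map ψ) (M.map ψ) = efProduct ν N M := by
  have hNM' : N.map ψ ≤ M.map ψ := (Subfield.gc_map_comap ψ).monotone_l hNM
  have h0' : (N.map ψ).relfinrank (M.map ψ) ≠ 0 := by rwa [Subfield.relfinrank_map_map]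
  apply le_antisymm
  · obtain ⟨b, hM, hb0, hb⟩ := (exists_vIndep (ν := ν') hNM' h0').2.2
    choose d hd hdb using hM
    obtain rfl : ψ ∘ d = b := funext hdb
    have := ((vIndep_map_iff h).1 hb).card_le hNM h0 hd fun i hi => hb0 i (by simp [hi])
    simpa using this
  · obtain ⟨b, hM, hb0, hb⟩ := (exists_vIndep (ν := ν) hNM h0).2.2
    have := ((vIndep_map_iff h).2 hb).card_le hNM' h0' (fun i => ⟨b i, hM i, rfl⟩)
      fun i => (map_ne_zero ψ).2 (hb0 i)
    simpa using this

end Transfer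

/-! ### Finitely generated subfields -/

section Closure

variable {L : Type*} [Field L]

lemma exists_finite_of_mem_closure {A B : Set L} {x : L} (hx : x ∈ Subfield.closure (A ∪ B)) :
    ∃ C, C.Finite ∧ C ⊆ A ∧ x ∈ Subfield.closure (C ∪ B) := by
  have hmono : ∀ {C D : Set L}, C ⊆ D → Subfield.closure (C ∪ B) ≤ Subfield.closure (D ∪ B) :=
    fun h => Subfield.closure_mono (Set.union_subset_union_left _ h)
  induction hx using Subfield.closure_induction with
  | mem x hx =>
    rcases hx with hx | hx
    · exact ⟨{x}, Set.finite_singleton x, Set.singleton_subset_iff.2 hx,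
        Subfield.subset_closure (Or.inl rfl)⟩
    · exact ⟨∅, Set.finite_empty, Set.empty_subset _, Subfield.subset_closure (Or.inr hx)⟩
  | one => exact ⟨∅, Set.finite_empty, Set.empty_subset _, one_mem _⟩
  | add x y _ _ hx hy =>
    obtain ⟨C, hC, hCA, hx⟩ := hx
    obtain ⟨D, hD, hDA, hy⟩ := hy
    exact ⟨C ∪ D, hC.union hD, Set.union_subset hCA hDA,
      add_mem (hmono Set.subset_union_left hx) (hmono Set.subset_union_right hy)⟩
  | neg x _ hx =>
    obtain ⟨C, hC, hCA, hx⟩ := hx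
    exact ⟨C, hC, hCA, neg_mem hx⟩
  | inv x _ hx =>
    obtain ⟨C, hC, hCA, hx⟩ := hx
    exact ⟨C, hC, hCA, inv_mem hx⟩
  | mul x y _ _ hx hy =>
    obtain ⟨C, hC, hCA, hx⟩ := hx
    obtain ⟨D, hD, hDA, hy⟩ := hy
    exact ⟨C ∪ D, hC.union hD, Set.union_subset hCA hDA,
      mul_mem (hmono Set.subset_union_left hx) (hmono Set.subset_union_right hy)⟩

lemma exists_finite_of_subset_closure {A B S : Set L} (hS : S.Finite)
    (h : S ⊆ Subfield.closure (A ∪ B)) :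
    ∃ C, C.Finite ∧ C ⊆ A ∧ S ⊆ Subfield.closure (C ∪ B) := by
  choose! C hC hCA hxC using fun x (hx : x ∈ S) => exists_finite_of_mem_closure (h hx)
  exact ⟨⋃ x ∈ S, C x, hS.biUnion hC, Set.iUnion₂_subset hCA, fun x hx =>
    Subfield.closure_mono (Set.union_subset_union_left _ (Set.subset_biUnion_of_mem hx))
      (hxC x hx)⟩

lemma le_closure_union (E : Subfield L) (B : Set L) : E ≤ Subfield.closure (E ∪ B) :=
  fun _ hx => Subfield.subset_closure (Or.inl hx)

lemma adjoin_toSubfield (E : Subfield L) (B : Set L) :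
    (IntermediateField.adjoin E B).toSubfield = Subfield.closure (E ∪ B) := by
  rw [IntermediateField.adjoin_toSubfield]
  congr 2
  ext x
  exact ⟨fun ⟨y, hy⟩ => hy ▸ y.2, fun hx => ⟨⟨x, hx⟩, rfl⟩⟩

lemma extendScalars_closure (E : Subfield L) (B : Set L) :
    Subfield.extendScalars (le_closure_union E B) = IntermediateField.adjoin E B := by
  apply IntermediateField.toSubfield_injective
  rw [adjoin_toSubfield]; rfl

lemma relfinrank_closure_singleton {E : Subfield L} {b : L} (hb : IsIntegral E b) :
    E.relfinrank (Subfield.closure (E ∪ {b})) = (minpoly E b).natDegree := by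
  rw [Subfield.relfinrank_eq_finrank_of_le (le_closure_union E _), extendScalars_closure]
  exact IntermediateField.adjoin.finrank hb

lemma relfinrank_closure_singleton_le {E : Subfield L} {b : L} {f : Polynomial L} (hf : f.Monic)
    (hE : ∀ n, f.coeff n ∈ E) (hb : f.eval b = 0) :
    E.relfinrank (Subfield.closure (E ∪ {b})) ≠ 0 ∧
      E.relfinrank (Subfield.closure (E ∪ {b})) ≤ f.natDegree := by
  have hl : f ∈ Polynomial.lifts (algebraMap E L) :=
    (Polynomial.lifts_iff_coeff_lifts _).2 fun n => ⟨⟨_, hE n⟩, rfl⟩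
  obtain ⟨g, rfl, hdeg, hg⟩ := Polynomial.lifts_and_natDegree_eq_and_monic hl hf
  have hb' : Polynomial.aeval b g = 0 := by rwa [Polynomial.eval_map_algebraMap] at hb
  have hint : IsIntegral E b := ⟨g, hg, hb'⟩
  rw [relfinrank_closure_singleton hint, ← hdeg]
  exact ⟨(minpoly.natDegree_pos hint).ne',
    Polynomial.natDegree_le_natDegree (minpoly.min E b hg hb')⟩

end Closure

/-! ### Finite extensions of inseparably defectless subfields -/

section PowerMap

variable {L Γ : Type*} [Field L] [LinearOrderedCommGroupWithZero Γ] (ν : Valuation L Γ)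

/-- Inseparable defectlessness of a subfield `N` of a valued field `(L, ν)`, relative to a fixed
power `φ` of the Frobenius: the finite extensions `M | φ N` inside `N` in which the valuation is
defectless are cofinal among all finite extensions of `φ N` inside `N`. By means of `φ⁻¹` these
correspond to the finite extensions of `N` inside `φ⁻¹ N`. -/
def FrobeniusDefectless (φ : L →+* L) (N : Subfield L) : Prop :=
  ∀ S : Set L, S.Finite → S ⊆ N → ∃ M : Subfield L, N.map φ ≤ M ∧ M ≤ N ∧ S ⊆ M ∧
    (N.map φ).relfinrank M ≠ 0 ∧ (N.map φ).relfinrank M ≤ efProduct ν (N.map φ) M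

variable {ν} {φ : L →+* L} {q : ℕ}

lemma le_iff_of_pow (hφ : ∀ x, φ x = x ^ q) (hq : q ≠ 0) (x y : L) :
    ν x ≤ ν y ↔ ν (φ x) ≤ ν (φ y) := by
  rw [hφ, hφ, map_pow, map_pow, pow_le_pow_iff_left₀ zero_le zero_le hq]

lemma map_le_of_pow (hφ : ∀ x, φ x = x ^ q) (N : Subfield L) : N.map φ ≤ N := by
  rintro _ ⟨x, hx, rfl⟩
  rw [hφ]; exact N.pow_mem hx q

/-- Inseparable defectlessness passes to simple algebraic extensions. Let `F = E(b)`. For a large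
enough finite extension `M` of `φ E` inside `E`, the field `F₀ = M(b)` satisfies
`[F₀ : M] ≤ [F : E] = [φ F : φ E]`, while `e * f` for `F₀ | M` is at least `e * f` for `F | E`,
which is `e * f` for `φ F | φ E`. Comparing the two towers from `φ E` to `F₀`, via `M` and via
`φ F`, gives the equality for `F₀ | φ F`. -/
lemma FrobeniusDefectless.closure_singleton (hφ : ∀ x, φ x = x ^ q) (hq : q ≠ 0) {E : Subfield L}
    (hE : FrobeniusDefectless ν φ E) {b : L} (hb : IsAlgebraic E b) :
    FrobeniusDefectless ν φ (Subfield.closure (E ∪ {b})) := by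
  classical
  intro S hS hSF
  set F := Subfield.closure (E ∪ {b}) with hF
  have hEF : E ≤ F := le_closure_union E _
  have hint := hb.isIntegral
  have hFE := relfinrank_closure_singleton hint
  have hFE0 : E.relfinrank F ≠ 0 := by rw [hFE]; exact (minpoly.natDegree_pos hint).ne'
  obtain ⟨a, haF, ha0, ha⟩ := (exists_vIndep (ν := ν) hEF hFE0).2.2
  set f := (minpoly E b).map (algebraMap E L) with hf
  obtain ⟨C, hC, hCE, hSC⟩ := exists_finite_of_subset_closure (hS.union (Set.finite_range a))
    (Set.union_subset hSF (Set.range_subset_iff.2 haF))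
  obtain ⟨M, hEM, hME, hCM, hM0, hM⟩ := hE (C ∪ f.coeffs) (hC.union f.coeffs.finite_toSet)
    (Set.union_subset hCE fun x hx => by
      obtain ⟨n, -, rfl⟩ := Polynomial.mem_coeffs_iff.1 hx
      rw [hf, Polynomial.coeff_map]; exact ((minpoly E b).coeff n).2)
  set F₀ := Subfield.closure ((M : Set L) ∪ {b}) with hF₀
  have hMF₀ : M ≤ F₀ := le_closure_union M _
  have hF₀F : F₀ ≤ F := Subfield.closure_mono (Set.union_subset_union_left _ hME)
  have hsub : (S ∪ Set.range a) ⊆ F₀ := hSC.trans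
    (Subfield.closure_mono (Set.union_subset_union_left _ (Set.subset_union_left.trans hCM)))
  have hφF : F.map φ ≤ F₀ := by
    rw [hF, RingHom.map_field_closure, Subfield.closure_le]
    rintro _ ⟨x, hx | hx, rfl⟩
    · exact hMF₀ (hEM ⟨x, hx, rfl⟩)
    · rw [hφ]; exact F₀.pow_mem (Subfield.subset_closure (Or.inr hx)) q
  have hφEF : E.map φ ≤ F.map φ := (Subfield.gc_map_comap φ).monotone_l hEF
  have hdeg : M.relfinrank F₀ ≠ 0 ∧ M.relfinrank F₀ ≤ f.natDegree := by
    refine relfinrank_closure_singleton_le ((minpoly.monic hint).map _) (fun n => ?_) ?_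
    · by_cases h0 : f.coeff n = 0
      · rw [h0]; exact M.zero_mem
      · exact hCM (Or.inr (Polynomial.coeff_mem_coeffs h0))
    · rw [hf, Polynomial.eval_map_algebraMap, minpoly.aeval]
  rw [hf, Polynomial.natDegree_map, ← hFE] at hdeg
  have hef : efProduct ν E F ≤ efProduct ν M F₀ := by
    have := (ha.mono (C := M) hME).card_le hMF₀ hdeg.1 (fun i => hsub (Or.inr ⟨i, rfl⟩)) ha0
    simpa using this
  have t1 := Subfield.relfinrank_mul_relfinrank hEM hMF₀
  have t2 := Subfield.relfinrank_mul_relfinrank hφEF hφF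
  have t3 := efProduct_mul_efProduct (ν := ν) hEM hMF₀
  have t4 := efProduct_mul_efProduct (ν := ν) hφEF hφF
  rw [Subfield.relfinrank_map_map] at t2
  rw [efProduct_map (le_iff_of_pow hφ hq) hEF hFE0] at t4
  have hpos : (F.map φ).relfinrank F₀ ≠ 0 := by
    intro h
    rw [h, mul_zero, ← t1] at t2
    exact mul_ne_zero hM0 hdeg.1 t2.symm
  refine ⟨F₀, hφF, hF₀F, Set.subset_union_left.trans hsub, hpos, ?_⟩
  have h1 : (F.map φ).relfinrank F₀ ≤ (E.map φ).relfinrank M := by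
    refine Nat.le_of_mul_le_mul_left ?_ (Nat.pos_of_ne_zero hFE0)
    rw [t2, ← t1, mul_comm]
    exact Nat.mul_le_mul_right _ hdeg.2
  have h2 : efProduct ν (E.map φ) M ≤ efProduct ν (F.map φ) F₀ := by
    refine Nat.le_of_mul_le_mul_left ?_ (Nat.pos_of_ne_zero (efProduct_ne_zero (ν := ν) hEF hFE0))
    rw [t4, ← t3, mul_comm]
    exact Nat.mul_le_mul_left _ hef
  exact h1.trans (hM.trans h2)

lemma FrobeniusDefectless.closure_finite (hφ : ∀ x, φ x = x ^ q) (hq : q ≠ 0) {E : Subfield L}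
    (hE : FrobeniusDefectless ν φ E) {X : Set L} (hX : X.Finite)
    (halg : ∀ x ∈ X, IsAlgebraic E x) :
    FrobeniusDefectless ν φ (Subfield.closure (E ∪ X)) := by
  induction X, hX using Set.Finite.induction_on with
  | empty => rwa [Set.union_empty, Subfield.closure_eq]
  | @insert b X _ _ ih =>
    have h := ih fun x hx => halg x (Set.mem_insert_of_mem _ hx)
    have hle := le_closure_union E X
    have hb : IsAlgebraic (Subfield.closure (E ∪ X)) b := by
      obtain ⟨f, hf0, hf⟩ := halg b (Set.mem_insert _ _)
      refine ⟨f.map (Subfield.inclusion hle), ?_, ?_⟩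
      · exact (Polynomial.map_ne_zero_iff (Subfield.inclusion hle).injective).2 hf0
      · rw [Polynomial.aeval_def, Polynomial.eval₂_map]; exact hf
    have := h.closure_singleton hφ hq hb
    convert this using 1
    apply le_antisymm
    · rw [Subfield.closure_le]
      rintro x (hx | rfl | hx)
      · exact le_closure_union _ _ (hle hx)
      · exact Subfield.subset_closure (Or.inr rfl)
      · exact le_closure_union _ _ (Subfield.subset_closure (Or.inr hx))
    · rw [Subfield.closure_le]
      rintro x (hx | rfl)
      · exact Subfield.closure_mono (Set.union_subset_union_right _ (Set.subset_insert _ _)) hx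
      · exact Subfield.subset_closure (Or.inr (Set.mem_insert _ _))

end PowerMap

/-! ### Rational function fields with the Gauss formula -/

section Monomials

variable {L Γ : Type*} [Field L] [LinearOrderedCommGroupWithZero Γ] {ν : Valuation L Γ}
  {ι : Type*} [Fintype ι]

/-- The monomial `t ^ μ` in a finite family `t` of field elements. -/
def monomialAt (t : ι → L) (μ : ι →₀ ℕ) : L := ∏ i, t i ^ μ i

lemma monomialAt_add (t : ι → L) (μ μ' : ι →₀ ℕ) :
    monomialAt t (μ + μ') = monomialAt t μ * monomialAt t μ' := by
  simp [monomialAt, pow_add, Finset.prod_mul_distrib]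

lemma monomialAt_smul (t : ι → L) (q : ℕ) (μ : ι →₀ ℕ) :
    monomialAt t (q • μ) = monomialAt t μ ^ q := by
  simp [monomialAt, pow_mul', Finset.prod_pow]

lemma map_monomialAt {L' : Type*} [Field L'] (ψ : L →+* L') (t : ι → L) (μ : ι →₀ ℕ) :
    ψ (monomialAt t μ) = monomialAt (ψ ∘ t) μ := by
  simp [monomialAt]

lemma monomialAt_ne_zero {t : ι → L} (ht : ∀ i, t i ≠ 0) (μ : ι →₀ ℕ) : monomialAt t μ ≠ 0 :=
  Finset.prod_ne_zero_iff.2 fun i _ => pow_ne_zero _ (ht i)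

lemma monomialAt_mem {t : ι → L} {N : Subfield L} (ht : ∀ i, t i ∈ N) (μ : ι →₀ ℕ) :
    monomialAt t μ ∈ N :=
  N.prod_mem fun i _ => N.pow_mem (ht i) _

lemma exists_sum_of_mem_adjoin {N : Subfield L} {t : ι → L} {x : L}
    (hx : x ∈ Algebra.adjoin N (Set.range t)) :
    ∃ (s : Finset (ι →₀ ℕ)) (c : (ι →₀ ℕ) → L), (∀ μ, c μ ∈ (N : Set L)) ∧
      x = ∑ μ ∈ s, c μ * monomialAt t μ := by
  rw [Algebra.adjoin_range_eq_range_aeval] at hx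
  obtain ⟨f, rfl⟩ := hx
  refine ⟨f.support, fun μ => (MvPolynomial.coeff μ f : N), fun μ => (MvPolynomial.coeff μ f).2, ?_⟩
  rw [AlgHom.toRingHom_eq_coe, RingHom.coe_coe, MvPolynomial.aeval_def, MvPolynomial.eval₂_eq']
  rfl

lemma exists_div_of_mem_closure {N : Subfield L} {B : Set L} {x : L}
    (hx : x ∈ Subfield.closure (N ∪ B)) :
    ∃ n ∈ Algebra.adjoin N B, ∃ d ∈ Algebra.adjoin N B, x = n / d := by
  rw [← adjoin_toSubfield] at hx
  obtain ⟨n, hn, d, hd, h⟩ := IntermediateField.mem_adjoin_iff_div.1 hx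
  exact ⟨n, hn, d, hd, h⟩

lemma relfinrank_le_of_span {N M : Subfield L} (h : N ≤ M) {κ : Type*} [Fintype κ] {a : κ → L}
    (ha : ∀ x ∈ M, x ∈ Submodule.span N (Set.range a)) :
    N.relfinrank M ≠ 0 ∧ N.relfinrank M ≤ Fintype.card κ := by
  rw [Subfield.relfinrank_eq_finrank_of_le h]
  have := Module.Finite.span_of_finite N (Set.finite_range a)
  have hle : Subalgebra.toSubmodule (Subfield.extendScalars h).toSubalgebra
      ≤ Submodule.span N (Set.range a) := fun x hx => ha x hx
  have hfin : Module.Finite N (Subalgebra.toSubmodule (Subfield.extendScalars h).toSubalgebra) :=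
    Submodule.finiteDimensional_of_le hle
  have hfin' : Module.Finite N (Subfield.extendScalars h) := hfin
  exact ⟨(Module.finrank_pos (R := N) (M := Subfield.extendScalars h)).ne',
    (Submodule.finrank_mono hle).trans (finrank_range_le_card a)⟩

lemma exists_spanning {N M : Subfield L} (h : N ≤ M) (h0 : N.relfinrank M ≠ 0) :
    ∃ b : Fin (N.relfinrank M) → L, ∀ x ∈ M, x ∈ Submodule.span N (Set.range b) := by
  rw [Subfield.relfinrank_eq_finrank_of_le h] at h0 ⊢
  have := Module.finite_of_finrank_pos (Nat.pos_of_ne_zero h0)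
  let B := Module.finBasis N (Subfield.extendScalars h)
  refine ⟨fun i => (B i : L), fun x hx => ?_⟩
  have h1 : (⟨x, hx⟩ : Subfield.extendScalars h) ∈ Submodule.span N (Set.range B) := by
    rw [B.span_eq]; trivial
  have h2 := Submodule.mem_map_of_mem (f := (Subfield.extendScalars h).val.toLinearMap) h1
  rw [Submodule.map_span, ← Set.range_comp] at h2
  exact h2

/-- The monomials of exponents below `q`, multiplied by generators of `M` over `φ K`, generate
`M(t)` over `φ (K(t))`: a fraction `n / d` with `n, d ∈ M[t]` equals `n * d ^ (q - 1) / φ d`. -/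
lemma mem_span_monomialAt {φ : L →+* L} {q : ℕ} (hφ : ∀ x, φ x = x ^ q) (hq : q ≠ 0)
    {K M : Subfield L} (hMK : M ≤ K) (t : ι → L) {κ : Type*} {b : κ → L}
    (hb : ∀ x ∈ M, x ∈ Submodule.span (K.map φ) (Set.range b)) {x : L}
    (hx : x ∈ Subfield.closure (M ∪ Set.range t)) :
    x ∈ Submodule.span ((Subfield.closure (K ∪ Set.range t)).map φ)
      (Set.range fun k : κ × (ι → Fin q) =>
        b k.1 * monomialAt t (Finsupp.equivFunOnFinite.symm fun i => (k.2 i : ℕ))) := by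
  set E := Subfield.closure (K ∪ Set.range t) with hE
  set V := Submodule.span (E.map φ) (Set.range fun k : κ × (ι → Fin q) =>
    b k.1 * monomialAt t (Finsupp.equivFunOnFinite.symm fun i => (k.2 i : ℕ))) with hV
  have hKE : K ≤ E := le_closure_union K _
  have htE : ∀ i, t i ∈ E := fun i => Subfield.subset_closure (Or.inr ⟨i, rfl⟩)
  -- the exponents are divided by `q` with remainder; the quotients go into the scalar `φ (t ^ _)`
  have hmon : ∀ (μ : ι →₀ ℕ), ∀ c ∈ M, c * monomialAt t μ ∈ V := by
    intro μ c hc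
    let r : ι → Fin q := fun i => ⟨μ i % q, Nat.mod_lt _ (Nat.pos_of_ne_zero hq)⟩
    have hμ : μ = (Finsupp.equivFunOnFinite.symm fun i => (r i : ℕ))
        + q • (Finsupp.equivFunOnFinite.symm fun i => μ i / q) := by
      ext i
      simp [r, Nat.mod_add_div]
    rw [hμ, monomialAt_add, monomialAt_smul, ← hφ]
    set m := monomialAt t (Finsupp.equivFunOnFinite.symm fun i => (r i : ℕ)) with hm
    set m' := monomialAt t (Finsupp.equivFunOnFinite.symm fun i => μ i / q) with hm'
    have hcm : c * m ∈ V := by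
      have h1 := hb c hc
      clear hc
      induction h1 using Submodule.span_induction with
      | mem x hx =>
        obtain ⟨k, rfl⟩ := hx
        exact Submodule.subset_span ⟨(k, r), rfl⟩
      | zero => rw [zero_mul]; exact V.zero_mem
      | add x y _ _ hx hy => rw [add_mul]; exact V.add_mem hx hy
      | smul a x _ hx =>
        have ha : (a : L) ∈ E.map φ := (Subfield.gc_map_comap φ).monotone_l hKE a.2
        have := V.smul_mem ⟨a, ha⟩ hx
        rw [Subfield.smul_def, smul_eq_mul] at this ⊢
        rwa [mul_assoc]
    have := V.smul_mem ⟨φ m', m', monomialAt_mem htE _, rfl⟩ hcm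
    rw [Subfield.smul_def, smul_eq_mul] at this
    rw [← mul_assoc, mul_comm]
    exact this
  have hadj : ∀ y ∈ Algebra.adjoin M (Set.range t), y ∈ V := by
    intro y hy
    obtain ⟨s, c, hc, rfl⟩ := exists_sum_of_mem_adjoin hy
    exact V.sum_mem fun μ _ => hmon μ _ (hc μ)
  obtain ⟨n, hn, d, hd, rfl⟩ := exists_div_of_mem_closure hx
  by_cases h0 : d = 0
  · rw [h0, div_zero]; exact V.zero_mem
  have hdE : d ∈ E := by
    obtain ⟨s, c, hc, rfl⟩ := exists_sum_of_mem_adjoin hd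
    exact E.sum_mem fun μ _ => E.mul_mem (hKE (hMK (hc μ))) (monomialAt_mem htE _)
  have hd' : (φ d)⁻¹ ∈ E.map φ := (E.map φ).inv_mem ⟨d, hdE, rfl⟩
  have := V.smul_mem ⟨_, hd'⟩ (hadj (n * d ^ (q - 1)) (mul_mem hn (pow_mem hd _)))
  rw [Subfield.smul_def, smul_eq_mul] at this
  convert this using 1
  change n / d = (φ d)⁻¹ * (n * d ^ (q - 1))
  rw [hφ]
  obtain ⟨q, rfl⟩ := Nat.exists_eq_succ_of_ne_zero hq
  simp only [Nat.succ_eq_add_one, Nat.add_sub_cancel]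
  field_simp
  ring

/-- Inseparable defectlessness passes from `K` to `K(t)` if the monomials in the family `t` are
valuation-independent over `K`, that is, if the valuation on `K[t]` is given by the Gauss formula.
For a finite extension `M | φ K` inside `K` with valuation basis `b`, the products of the `b i`
and the monomials with exponents below `q` form a valuation basis of `M(t) | φ (K(t))`. -/
lemma FrobeniusDefectless.closure_range {φ : L →+* L} {q : ℕ} (hφ : ∀ x, φ x = x ^ q)
    (hq : q ≠ 0) {K : Subfield L} (hK : FrobeniusDefectless ν φ K) {t : ι → L} (ht0 : ∀ i, t i ≠ 0)
    (ht : VIndep ν K (monomialAt t)) :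
    FrobeniusDefectless ν φ (Subfield.closure (K ∪ Set.range t)) := by
  classical
  intro S hS hSE
  set E := Subfield.closure (K ∪ Set.range t) with hE
  obtain ⟨C, hC, hCK, hSC⟩ := exists_finite_of_subset_closure hS hSE
  obtain ⟨M, hKM, hMK, hCM, hM0, hM⟩ := hK C hC hCK
  set E₀ := Subfield.closure ((M : Set L) ∪ Set.range t) with hE₀
  have hME₀ : M ≤ E₀ := le_closure_union M _
  have htE₀ : ∀ i, t i ∈ E₀ := fun i => Subfield.subset_closure (Or.inr ⟨i, rfl⟩)
  have hE₀E : E₀ ≤ E := Subfield.closure_mono (Set.union_subset_union_left _ hMK)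
  have hφE : E.map φ = Subfield.closure (K.map φ ∪ Set.range (φ ∘ t)) := by
    rw [hE, RingHom.map_field_closure, Set.image_union, ← Set.range_comp]; rfl
  have hφEE₀ : E.map φ ≤ E₀ := by
    rw [hφE, Subfield.closure_le]
    rintro _ (hx | ⟨i, rfl⟩)
    · exact hME₀ (hKM hx)
    · rw [Function.comp_apply, hφ]; exact E₀.pow_mem (htE₀ i) q
  obtain ⟨b', hb'⟩ := exists_spanning hKM hM0
  obtain ⟨hdeg0, hdeg⟩ := relfinrank_le_of_span hφEE₀
    fun x hx => mem_span_monomialAt hφ hq hMK t hb' hx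
  refine ⟨E₀, hφEE₀, hE₀E, hSC.trans (Subfield.closure_mono (Set.union_subset_union_left _ hCM)),
    hdeg0, hdeg.trans ?_⟩
  obtain ⟨b, hbM, hb0, hb⟩ := (exists_vIndep (ν := ν) hKM hM0).2.2
  have h1 : VIndep ν (K.map φ) fun k : (ι →₀ ℕ) × Fin (efProduct ν (K.map φ) M) =>
      monomialAt t k.1 * b k.2 := VIndep.mul ht hb fun s c hc =>
    K.sum_mem fun j hj => K.mul_mem (map_le_of_pow hφ K (hc j hj)) (hMK (hbM j))
  let e : (ι → Fin q) → (ι →₀ ℕ) := fun r => Finsupp.equivFunOnFinite.symm fun i => (r i : ℕ)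
  let f : (Fin (efProduct ν (K.map φ) M) × (ι → Fin q)) × (ι →₀ ℕ) →
      (ι →₀ ℕ) × Fin (efProduct ν (K.map φ) M) := fun k => (e k.1.2 + q • k.2, k.1.1)
  have hf : Function.Injective f := by
    rintro ⟨⟨i, r⟩, μ⟩ ⟨⟨i', r'⟩, μ'⟩ h
    obtain ⟨h, rfl⟩ := Prod.ext_iff.1 h
    have h' : ∀ j, (r j : ℕ) + q * μ j = r' j + q * μ' j := fun j => by
      simpa [f, e] using DFunLike.congr_fun h j
    have hr : r = r' := funext fun j => Fin.ext (by
      have := congrArg (· % q) (h' j)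
      simpa [Nat.add_mul_mod_self_left, Nat.mod_eq_of_lt (r j).2, Nat.mod_eq_of_lt (r' j).2]
        using this)
    subst hr
    have hμ : μ = μ' := Finsupp.ext fun j =>
      Nat.eq_of_mul_eq_mul_left (Nat.pos_of_ne_zero hq) (Nat.add_left_cancel (h' j))
    rw [hμ]
  -- `t ^ (r + q * μ)` is `t ^ r` times the image of `t ^ μ` under `φ`
  have h2 : VIndep ν (K.map φ) fun k : (Fin (efProduct ν (K.map φ) M) × (ι → Fin q)) × (ι →₀ ℕ) =>
      (b k.1.1 * monomialAt t (e k.1.2)) * monomialAt (φ ∘ t) k.2 := by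
    convert h1.comp hf using 2 with k
    rw [Function.comp_apply, monomialAt_add, monomialAt_smul, ← hφ, map_monomialAt]
    ring
  have h3 := VIndep.of_mul (a := fun k : Fin (efProduct ν (K.map φ) M) × (ι → Fin q) =>
    b k.1 * monomialAt t (e k.2)) (D := (Algebra.adjoin (K.map φ) (Set.range (φ ∘ t))).toSubring)
    (K.map φ).zero_mem h2 fun x hx => exists_sum_of_mem_adjoin hx
  have h4 := h3.of_div (D := E.map φ) fun x hx => by
    rw [hφE] at hx
    exact exists_div_of_mem_closure hx
  refine le_trans ?_ (h4.card_le hφEE₀ hdeg0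
    (fun k => E₀.mul_mem (hME₀ (hbM _)) (monomialAt_mem htE₀ _))
    fun k => mul_ne_zero (hb0 _) (monomialAt_ne_zero ht0 _))
  simp only [Fintype.card_prod, Fintype.card_fin]
  exact Nat.mul_le_mul_right _ hM

/-- The Gauss formula for a family of elements whose values are independent modulo the value group
of `N`, together with integral elements whose residues are algebraically independent. -/
lemma vIndep_monomialAt_sumElim {N : Subfield L} {σ τ : Type*} [Fintype σ] [Fintype τ] {x : σ → L}
    {y : τ → ν.valuationSubring}
    (hx : ∀ μ μ' : σ →₀ ℕ, μ ≠ μ' → ∀ c ∈ N, ∀ c' ∈ N, ν (c * monomialAt x μ) ≠ 0 →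
      ν (c * monomialAt x μ) ≠ ν (c' * monomialAt x μ'))
    (hy : LinearIndependent (resFieldOf ν N) fun μ : τ →₀ ℕ =>
      monomialAt (fun i => IsLocalRing.residue ν.valuationSubring (y i)) μ) :
    VIndep ν N (monomialAt (Sum.elim x fun i => (y i : L))) := by
  have h := VIndep.mul_of_residue (N := N) (a := monomialAt x)
    (u := fun μ : τ →₀ ℕ => ∏ i, y i ^ μ i) hx (by
      simpa only [map_prod, map_pow, monomialAt] using hy)
  convert h.comp (Finsupp.sumFinsuppEquivProdFinsupp (α := σ) (β := τ) (γ := ℕ)).injective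
    using 1
  funext μ
  simp [monomialAt]

end Monomials

/-! ### Invariants of an extension in terms of subfields -/

section Comparison

variable {K L Γ : Type*} [Field K] [Field L] [Algebra K L] [LinearOrderedCommGroupWithZero Γ]
  {ν : Valuation L Γ}

lemma valGroup_restrictTo (ν : Valuation L Γ) :
    valGroup (restrictTo K ν) = valGroupOf ν (algebraMap K L).fieldRange := by
  ext g
  rw [← SetLike.mem_coe, ← MonoidWithZeroHom.valueMonoid_eq_valueGroup']
  constructor
  · rintro ⟨x, hx⟩
    exact ⟨algebraMap K L x, ⟨x, rfl⟩, hx⟩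
  · rintro ⟨_, ⟨x, rfl⟩, hx⟩
    exact ⟨x, hx⟩

lemma valGroup_eq (ν : Valuation L Γ) : valGroup ν = valGroupOf ν ⊤ := by
  ext g
  rw [← SetLike.mem_coe, ← MonoidWithZeroHom.valueMonoid_eq_valueGroup']
  constructor
  · rintro ⟨x, hx⟩
    exact ⟨x, trivial, hx⟩
  · rintro ⟨x, -, hx⟩
    exact ⟨x, hx⟩

lemma resFieldOf_top (ν : Valuation L Γ) : resFieldOf ν ⊤ = ⊤ := by
  refine eq_top_iff.2 fun a _ => ?_
  obtain ⟨x, rfl⟩ := IsLocalRing.residue_surjective a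
  exact ⟨x, trivial, rfl⟩

lemma fieldRange_algebraMap_resField (ν : Valuation L Γ) :
    (algebraMap (ResField (restrictTo K ν)) (ResField ν)).fieldRange
      = resFieldOf ν (algebraMap K L).fieldRange := by
  ext a
  constructor
  · rintro ⟨x, rfl⟩
    obtain ⟨x, rfl⟩ := IsLocalRing.residue_surjective x
    exact ⟨algebraMap _ ν.valuationSubring x, ⟨x, rfl⟩, rfl⟩
  · rintro ⟨⟨_, hx⟩, ⟨x, rfl⟩, rfl⟩
    exact ⟨IsLocalRing.residue _ ⟨x, hx⟩, rfl⟩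

lemma finrank_eq_finrank_fieldRange (K L : Type*) [Field K] [Field L] [Algebra K L] :
    Module.finrank K L = Module.finrank (algebraMap K L).fieldRange L :=
  Algebra.finrank_eq_of_equiv_equiv (RingHom.rangeRestrictFieldEquiv (algebraMap K L))
    (RingEquiv.refl L) (by ext; rfl)

/-- The invariants of the extension `(L | K, ν)` are those of the image of `K` in `L`. -/
lemma ramificationIndex_mul_inertiaDegree (ν : Valuation L Γ) :
    ramificationIndex K ν * inertiaDegree K ν = efProduct ν (algebraMap K L).fieldRange ⊤ := by
  rw [ramificationIndex, inertiaDegree, efProduct, valGroup_restrictTo, valGroup_eq, resFieldOf_top,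
    Subfield.relfinrank_top_right, finrank_eq_finrank_fieldRange,
    fieldRange_algebraMap_resField]

end Comparison

/-! ### Purely inseparable extensions -/

section PurelyInseparable

variable {K L Γ : Type*} [Field K] [Field L] [Algebra K L] [LinearOrderedCommGroupWithZero Γ]
  {ν : Valuation K Γ} {φ : L →+* K} {q : ℕ}

/-- A valuation has exactly one extension to a purely inseparable extension of finite exponent. -/
lemma extensions_eq_singleton (hφ : ∀ x, algebraMap K L (φ x) = x ^ q) (hq : q ≠ 0) :
    Extensions ν L = {(ν.comap φ).valuationSubring} := by
  have hpow : ∀ (B : ValuationSubring L) (x : L), x ^ q ∈ B ↔ x ∈ B := fun B x => by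
    rw [← B.valuation_le_one_iff, ← B.valuation_le_one_iff, map_pow, pow_le_one_iff hq]
  ext B
  rw [Set.mem_singleton_iff, Extensions, Set.mem_ofPred_eq]
  constructor
  · intro h
    ext x
    rw [← hpow, ← hφ, ← ValuationSubring.mem_comap, h]
    rfl
  · rintro rfl
    ext k
    have : φ (algebraMap K L k) = k ^ q := (algebraMap K L).injective (by rw [hφ, map_pow])
    rw [ValuationSubring.mem_comap, Valuation.mem_valuationSubring_iff, Valuation.comap_apply, this,
      map_pow, pow_le_one_iff hq]
    rfl

lemma finrank_eq_relfinrank (φ : L →+* K) :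
    Module.finrank K L = (φ.comp (algebraMap K L)).fieldRange.relfinrank φ.fieldRange := by
  rw [finrank_eq_finrank_fieldRange, ← Subfield.relfinrank_top_right,
    ← Subfield.relfinrank_map_map _ _ φ]
  simp only [RingHom.fieldRange_eq_map, Subfield.map_map]

/-- Defectlessness in a purely inseparable extension, read off after applying a power of the
Frobenius. -/
lemma isDefectlessIn_iff [FiniteDimensional K L] (hφ : ∀ x, algebraMap K L (φ x) = x ^ q)
    (hq : q ≠ 0) : IsDefectlessIn ν L ↔
      (φ.comp (algebraMap K L)).fieldRange.relfinrank φ.fieldRange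
        = efProduct ν (φ.comp (algebraMap K L)).fieldRange φ.fieldRange := by
  have h0 : (algebraMap K L).fieldRange.relfinrank ⊤ ≠ 0 := by
    rw [Subfield.relfinrank_top_right, ← finrank_eq_finrank_fieldRange]
    exact Module.finrank_pos.ne'
  have h := efProduct_map (ν := (ν.comap φ).valuationSubring.valuation) (ν' := ν) (ψ := φ)
    (fun x y => ((Valuation.isEquiv_valuation_valuationSubring (ν.comap φ)) x y).symm) le_top h0
  rw [IsDefectlessIn, extensions_eq_singleton hφ hq, finsum_mem_singleton,
    ramificationIndex_mul_inertiaDegree, ← h, finrank_eq_relfinrank φ]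
  simp only [RingHom.fieldRange_eq_map, Subfield.map_map]

lemma relfinrank_closure_ne_zero {N : Subfield L} {S : Set L} (hS : S.Finite)
    (h : ∀ x ∈ S, IsIntegral N x) : N.relfinrank (Subfield.closure (N ∪ S)) ≠ 0 := by
  rw [Subfield.relfinrank_eq_finrank_of_le (le_closure_union N _), extendScalars_closure]
  have := hS.to_subtype
  have := IntermediateField.finiteDimensional_adjoin h
  exact Module.finrank_pos.ne'

end PurelyInseparable

/-! ### Defectlessness and powers of the Frobenius -/

section Frobenius

variable {K : Type v} {F : Type u} {Γ : Type w} [Field K] [Field F] [Algebra K F]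
  [LinearOrderedCommGroupWithZero Γ] {ν : Valuation F Γ}

/-- An inseparably defectless field is so relative to every power of the Frobenius: the finite
extensions `M` of `K ^ q` inside `K` are turned into purely inseparable extensions of `K` by
letting `K` act through the Frobenius. -/
lemma IsInseparablyDefectless.frobeniusDefectless (p n : ℕ) [ExpChar K p] [ExpChar F p]
    (hK : IsInseparablyDefectless (restrictTo K ν)) :
    FrobeniusDefectless ν (iterateFrobenius F p n) (algebraMap K F).fieldRange := by
  intro S hS hSK
  have hq : p ^ n ≠ 0 := (expChar_pow_pos K p n).ne'
  set Φ := iterateFrobenius K p n with hΦ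
  have hΦx : ∀ x, Φ x = x ^ p ^ n := fun x => iterateFrobenius_def p n x
  set S' := algebraMap K F ⁻¹' S with hS'
  have hS'fin : S'.Finite := hS.preimage (algebraMap K F).injective.injOn
  set M := Subfield.closure (Φ.fieldRange ∪ S') with hM
  have hΦM : Φ.fieldRange ≤ M := le_closure_union _ _
  have hint : ∀ x : K, IsIntegral Φ.fieldRange x := fun x => by
    refine IsIntegral.of_pow (Nat.pos_of_ne_zero hq) ?_
    rw [← hΦx]
    exact isIntegral_algebraMap (R := Φ.fieldRange) (x := ⟨Φ x, x, rfl⟩)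
  have hM0 := relfinrank_closure_ne_zero hS'fin fun x _ => hint x
  let _ : Algebra K M := (Φ.codRestrict M fun x => hΦM ⟨x, rfl⟩).toAlgebra
  have halg : ∀ x, ((algebraMap K M x : M) : K) = Φ x := fun x => rfl
  have hφ : ∀ x : M, algebraMap K M (M.subtype x) = x ^ p ^ n := fun x =>
    Subtype.ext (by rw [halg, hΦx]; rfl)
  have hcomp : M.subtype.comp (algebraMap K M) = Φ := RingHom.ext halg
  have hsub : M.subtype.fieldRange = M := by
    ext x; exact ⟨fun ⟨y, hy⟩ => hy ▸ y.2, fun hx => ⟨⟨x, hx⟩, rfl⟩⟩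
  have : FiniteDimensional K M := Module.finite_of_finrank_pos (by
    rw [finrank_eq_relfinrank M.subtype, hcomp, hsub]; exact Nat.pos_of_ne_zero hM0)
  have : IsPurelyInseparable K M :=
    (isPurelyInseparable_iff_pow_mem K p).2 fun x => ⟨n, _, hφ x⟩
  have key := (isDefectlessIn_iff hφ hq).1 (hK M)
  rw [hcomp, hsub] at key
  have hmap : (algebraMap K F).fieldRange.map (iterateFrobenius F p n)
      = Φ.fieldRange.map (algebraMap K F) := by
    simp only [RingHom.fieldRange_eq_map, Subfield.map_map]
    congr 1
    ext x
    simp [hΦx, iterateFrobenius_def]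
  have hef := efProduct_map (ν := restrictTo K ν) (ν' := ν) (ψ := algebraMap K F)
    (fun x y => Iff.rfl) hΦM hM0
  refine ⟨M.map (algebraMap K F), ?_, ?_, ?_, ?_, ?_⟩
  · rw [hmap]; exact (Subfield.gc_map_comap _).monotone_l hΦM
  · rintro _ ⟨x, -, rfl⟩; exact ⟨x, rfl⟩
  · intro x hx
    obtain ⟨y, rfl⟩ := hSK hx
    exact ⟨y, Subfield.subset_closure (Or.inr hx), rfl⟩
  · rw [hmap, Subfield.relfinrank_map_map]; exact hM0
  · rw [hmap, Subfield.relfinrank_map_map, hef, key]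

/-- A field that is inseparably defectless relative to all powers of the Frobenius is inseparably
defectless, since a finite purely inseparable extension of exponent at most `n` is embedded into
`F` by the `n`-th power of the Frobenius, and defectlessness passes to subextensions. -/
lemma isInseparablyDefectless_of_frobeniusDefectless (p : ℕ) [ExpChar F p]
    (h : ∀ n, FrobeniusDefectless ν (iterateFrobenius F p n) ⊤) : IsInseparablyDefectless ν := by
  intro L _ _ _ _
  set n := IsPurelyInseparable.exponent F L with hn
  have hq : p ^ n ≠ 0 := (expChar_pow_pos F p n).ne'
  set φ := IsPurelyInseparable.iterateFrobenius F L p hn.symm.le with hφdef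
  have hφ : ∀ x, algebraMap F L (φ x) = x ^ p ^ n :=
    IsPurelyInseparable.algebraMap_iterateFrobenius F p _
  have hcomp : φ.comp (algebraMap F L) = iterateFrobenius F p n := by
    ext x
    apply (algebraMap F L).injective
    rw [RingHom.comp_apply, hφ, iterateFrobenius_def, map_pow]
  refine (isDefectlessIn_iff hφ hq).2 ?_
  rw [hcomp, RingHom.fieldRange_eq_map (iterateFrobenius F p n)]
  let b := Module.finBasis F L
  obtain ⟨M, hFM, -, hbM, hM0, hM⟩ := h n (Set.range fun i => φ (b i)) (Set.finite_range _)
    fun _ _ => trivial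
  have hle : (⊤ : Subfield F).map (iterateFrobenius F p n) ≤ φ.fieldRange := by
    rintro _ ⟨x, -, rfl⟩
    exact ⟨algebraMap F L x, by rw [← hcomp]; rfl⟩
  have hle' : φ.fieldRange ≤ M := by
    rintro _ ⟨x, rfl⟩
    rw [← b.sum_repr x, map_sum]
    refine M.sum_mem fun i _ => ?_
    rw [Algebra.smul_def, map_mul]
    refine M.mul_mem (hFM ⟨b.repr x i, trivial, ?_⟩) (hbM ⟨i, rfl⟩)
    rw [← hcomp]; rfl
  have t1 := Subfield.relfinrank_mul_relfinrank hle hle'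
  have t2 := efProduct_mul_efProduct (ν := ν) hle hle'
  have h1 : ((⊤ : Subfield F).map (iterateFrobenius F p n)).relfinrank φ.fieldRange ≠ 0 :=
    fun h => hM0 (by rw [← t1, h, zero_mul])
  have h2 : φ.fieldRange.relfinrank M ≠ 0 := fun h => hM0 (by rw [← t1, h, mul_zero])
  refine le_antisymm ?_ (efProduct_le_relfinrank hle h1)
  refine Nat.le_of_mul_le_mul_right ?_ (Nat.pos_of_ne_zero h2)
  calc _ = _ := t1
    _ ≤ _ := hM
    _ = _ := t2.symm
    _ ≤ _ := Nat.mul_le_mul_left _ (efProduct_le_relfinrank hle' h2)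

end Frobenius

/-! ### Transcendence bases of extensions without transcendence defect -/

section TranscendenceBasis

variable {K : Type v} {F : Type u} {Γ : Type w} [Field K] [Field F] [Algebra K F]
  [LinearOrderedCommGroupWithZero Γ] {ν : Valuation F Γ}

lemma rationalRank_eq (ν : Valuation F Γ) :
    rationalRank K ν = Module.rank ℤ (Additive (ValueGroupQuotient K ν)) := by
  have : IsLocalizedModule (nonZeroDivisors ℤ)
      (TensorProduct.mk ℤ ℚ (Additive (ValueGroupQuotient K ν)) 1) :=
    (isLocalizedModule_iff_isBaseChange (nonZeroDivisors ℤ) ℚ _).2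
      (TensorProduct.isBaseChange _ _ _)
  rw [rationalRank, ← IsLocalizedModule.rank_eq (nonZeroDivisors ℤ) le_rfl
    (TensorProduct.mk ℤ ℚ (Additive (ValueGroupQuotient K ν)) 1)]
  exact IsLocalization.rank_eq ℚ (nonZeroDivisors ℤ) le_rfl

/-- Elements of `F` whose values are rationally independent modulo the value group of `K`, as many
as the rational rank allows. -/
lemma exists_values_independent {r : ℕ} (hr : rationalRank K ν = r) :
    ∃ x : Fin r → F, (∀ i, x i ≠ 0) ∧ ∀ μ μ' : Fin r →₀ ℕ, μ ≠ μ' →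
      ∀ c ∈ (algebraMap K F).fieldRange, ∀ c' ∈ (algebraMap K F).fieldRange,
      ν (c * monomialAt x μ) ≠ 0 → ν (c * monomialAt x μ) ≠ ν (c' * monomialAt x μ') := by
  rw [rationalRank_eq] at hr
  obtain ⟨s, hs, hind⟩ := exists_finset_linearIndependent_of_le_rank hr.ge
  let e := (s.equivFinOfCardEq hs).symm
  let a : Fin r → Additive (ValueGroupQuotient K ν) := fun i => e i
  have ha : LinearIndependent ℤ a := hind.comp e e.injective
  choose g hg using fun i => QuotientGroup.mk_surjective (Additive.toMul (a i))
  have hx : ∀ i, ∃ x : F, ν x = (g i : Γˣ) := fun i => by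
    obtain ⟨x, -, hx⟩ := (valGroup_eq ν).le (g i).2
    exact ⟨x, hx⟩
  choose x hx using hx
  have hx0 : ∀ i, x i ≠ 0 := fun i hi => by
    have := hx i
    rw [hi, map_zero] at this
    exact (Units.ne_zero _) this.symm
  refine ⟨x, hx0, fun μ μ' hμ c hc c' hc' hne heq => hμ ?_⟩
  let γ : (Fin r →₀ ℕ) → valGroup ν := fun μ => ∏ i, g i ^ μ i
  have hγ : ∀ μ, ν (monomialAt x μ) = (γ μ : Γˣ) := fun μ => by
    simp [γ, monomialAt, hx]
  have hc0' : ν c' ≠ 0 := fun h0 => by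
    rw [heq, map_mul, h0, zero_mul] at hne; exact hne rfl
  have hmk : (QuotientGroup.mk (γ μ) : ValueGroupQuotient K ν) = QuotientGroup.mk (γ μ') := by
    refine QuotientGroup.eq.2 ?_
    rw [Subgroup.mem_subgroupOf, valGroup_restrictTo]
    refine ⟨c / c', div_mem hc hc', ?_⟩
    rw [map_mul, map_mul, hγ, hγ] at heq
    rw [map_div₀]
    simp only [Subgroup.coe_mul, Subgroup.coe_inv, Units.val_mul, Units.val_inv_eq_inv_val]
    rw [div_eq_iff hc0', eq_comm, inv_mul_eq_div, div_mul_eq_mul_div,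
      div_eq_iff (Units.ne_zero _), heq, mul_comm]
  have hsum : ∀ μ, (Additive.ofMul (QuotientGroup.mk (γ μ) : ValueGroupQuotient K ν))
      = ∑ i, (μ i : ℤ) • a i := fun μ => by
    have h1 : (QuotientGroup.mk (γ μ) : ValueGroupQuotient K ν)
        = ∏ i, (QuotientGroup.mk (g i) : ValueGroupQuotient K ν) ^ μ i := by
      have := map_prod (QuotientGroup.mk' ((valGroup (restrictTo K ν)).subgroupOf (valGroup ν)))
        (fun i => g i ^ μ i) Finset.univ
      simp only [QuotientGroup.mk'_apply, QuotientGroup.mk_pow] at this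
      exact this
    rw [h1, ofMul_prod]
    refine Finset.sum_congr rfl fun i _ => ?_
    rw [hg, natCast_zsmul]; rfl
  have h := Fintype.linearIndependent_iff.1 ha (fun i => (μ i : ℤ) - μ' i) (by
    simp only [sub_smul, Finset.sum_sub_distrib]
    rw [← hsum, ← hsum, hmk, sub_self])
  ext i
  exact_mod_cast sub_eq_zero.1 (h i)

lemma linearIndependent_monomialAt_residue {τ : Type*} [Fintype τ] {y : τ → ResField ν}
    (hy : AlgebraicIndependent (ResField (restrictTo K ν)) y) :
    LinearIndependent (resFieldOf ν (algebraMap K F).fieldRange) fun μ : τ →₀ ℕ =>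
      monomialAt y μ := by
  classical
  rw [linearIndependent_iff']
  intro s g hg μ hμ
  choose h hh using fun μ => (fieldRange_algebraMap_resField (K := K) ν).ge (g μ).2
  have h0 : MvPolynomial.aeval y (∑ μ ∈ s, MvPolynomial.monomial μ (h μ)) = 0 := by
    rw [map_sum, ← hg]
    refine Finset.sum_congr rfl fun μ _ => ?_
    rw [MvPolynomial.aeval_monomial, Finsupp.prod_fintype _ _ (by simp)]
    exact congrArg (· * _) (hh μ)
  have h1 := congrArg (MvPolynomial.coeff μ) ((algebraicIndependent_iff.1 hy) _ h0)
  rw [MvPolynomial.coeff_sum] at h1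
  simp only [MvPolynomial.coeff_monomial, MvPolynomial.coeff_zero] at h1
  rw [Finset.sum_ite_eq' s μ h, if_pos hμ] at h1
  exact Subtype.ext (by rw [← hh, h1]; exact map_zero (algebraMap _ _))

lemma algebraicIndependent_of_vIndep {ι : Type*} [Fintype ι] {t : ι → F} (ht0 : ∀ i, t i ≠ 0)
    (ht : VIndep ν (algebraMap K F).fieldRange (monomialAt t)) : AlgebraicIndependent K t := by
  rw [algebraicIndependent_iff]
  intro f hf
  rw [MvPolynomial.aeval_def, MvPolynomial.eval₂_eq'] at hf
  ext μ
  by_cases hμ : μ ∈ f.support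
  · have := ht f.support (fun μ => algebraMap K F (f.coeff μ)) (fun μ _ => ⟨_, rfl⟩) μ hμ
    simp only [monomialAt, hf, map_zero, le_zero_iff, map_eq_zero] at this
    rw [MvPolynomial.coeff_zero]
    exact (map_eq_zero _).1 ((mul_eq_zero.1 this).resolve_right (monomialAt_ne_zero ht0 μ))
  · rw [MvPolynomial.notMem_support_iff.1 hμ, MvPolynomial.coeff_zero]

/-- An extension without transcendence defect has a transcendence basis for which the Gauss formula
holds. -/
lemma WithoutTranscendenceDefect.exists_isTranscendenceBasis
    (h : WithoutTranscendenceDefect K ν) : ∃ (ι : Type u) (_ : Fintype ι) (t : ι → F),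
      (∀ i, t i ≠ 0) ∧ IsTranscendenceBasis K t ∧
      VIndep ν (algebraMap K F).fieldRange (monomialAt t) := by
  obtain ⟨hfin, heq⟩ := h
  have hlt : Cardinal.lift.{u} (rationalRank K ν) + Cardinal.lift.{w} (residueTrdeg K ν)
      < Cardinal.aleph0 := by rw [← heq]; simpa using hfin
  obtain ⟨h1, h2⟩ := Cardinal.add_lt_aleph0_iff.1 hlt
  rw [Cardinal.lift_lt_aleph0] at h1 h2
  obtain ⟨r, hr⟩ := Cardinal.lt_aleph0.1 h1
  obtain ⟨x, hx0, hx⟩ := exists_values_independent hr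
  obtain ⟨s, hs⟩ := _root_.exists_isTranscendenceBasis (ResField (restrictTo K ν)) (ResField ν)
  have hcard := hs.cardinalMk_eq_trdeg
  have : Finite s := by
    rw [← Cardinal.lt_aleph0_iff_finite, hcard]; exact h2
  have := Fintype.ofFinite s
  choose y hy using fun i : s => IsLocalRing.residue_surjective (R := ν.valuationSubring) i.1
  have hV := vIndep_monomialAt_sumElim (x := x) (y := y) hx (by
    simp only [hy]; exact linearIndependent_monomialAt_residue hs.1)
  have ht0 : ∀ i, Sum.elim x (fun i => (y i : F)) i ≠ 0 := by
    rintro (i | i)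
    · exact hx0 i
    · intro hi
      have h0 : y i = 0 := Subtype.ext hi
      exact hs.1.ne_zero i (by rw [← hy, h0, map_zero])
  have halg := algebraicIndependent_of_vIndep ht0 hV
  have hle : Algebra.trdeg K F ≤ Cardinal.mk (Fin r ⊕ s) := by
    rw [← Cardinal.lift_le.{w}, heq, hr, Cardinal.mk_sum, hcard]
    simp [residueTrdeg]
  exact ⟨Fin r ⊕ s, inferInstance, _, ht0,
    halg.isTranscendenceBasis_of_trdeg_le_of_finite hle, hV⟩

end TranscendenceBasis

end ValuedExtension

theorem proposition3p1 {K : Type v} {F : Type u} {Γ : Type w} [Field K] [Field F] [Algebra K F]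
    [LinearOrderedCommGroupWithZero Γ] (ν : Valuation F Γ)
    (hF : ValuedExtension.IsFunctionField K F)
    (hν : ValuedExtension.WithoutTranscendenceDefect K ν)
    (hK : ValuedExtension.IsInseparablyDefectless (ValuedExtension.restrictTo K ν)) :
    ValuedExtension.IsInseparablyDefectless ν := by
  -- In characteristic `0` the exponent `p` is `1` and all power maps are the identity.
  obtain ⟨p, _⟩ := ExpChar.exists K
  have : ExpChar F p := expChar_of_injective_algebraMap (algebraMap K F).injective p
  refine ValuedExtension.isInseparablyDefectless_of_frobeniusDefectless p fun n => ?_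
  have hq : p ^ n ≠ 0 := (expChar_pow_pos K p n).ne'
  have hφ : ∀ x : F, iterateFrobenius F p n x = x ^ p ^ n := iterateFrobenius_def p n
  obtain ⟨ι, _, t, ht0, htb, ht⟩ := hν.exists_isTranscendenceBasis
  have hE := (hK.frobeniusDefectless p n).closure_range hφ hq ht0 ht
  set E := Subfield.closure (((algebraMap K F).fieldRange : Set F) ∪ Set.range t) with hEdef
  have hKE : ∀ k, algebraMap K F k ∈ E := fun k => Subfield.subset_closure (Or.inl ⟨k, rfl⟩)
  have hEadj : E = (IntermediateField.adjoin K (Set.range t)).toSubfield := by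
    rw [IntermediateField.adjoin_toSubfield]; rfl
  have halg : ∀ x : F, IsAlgebraic E x := by
    intro x
    have := htb.isAlgebraic_field
    obtain ⟨f, hf0, hf⟩ := Algebra.IsAlgebraic.isAlgebraic
      (R := IntermediateField.adjoin K (Set.range t)) x
    refine ⟨f.map (Subfield.inclusion hEadj.ge), ?_, ?_⟩
    · exact (Polynomial.map_ne_zero_iff (Subfield.inclusion hEadj.ge).injective).2 hf0
    · rw [Polynomial.aeval_def, Polynomial.eval₂_map]; exact hf
  obtain ⟨X, hX⟩ := hF
  have htop : Subfield.closure ((E : Set F) ∪ X) = ⊤ := by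
    refine top_unique ?_
    rw [← IntermediateField.top_toSubfield (F := K), ← hX, IntermediateField.adjoin_toSubfield,
      Subfield.closure_le]
    rintro x (⟨k, rfl⟩ | hx)
    · exact Subfield.subset_closure (Or.inl (hKE k))
    · exact Subfield.subset_closure (Or.inr hx)
  rw [← htop]
  exact hE.closure_finite hφ hq X.finite_toSet fun x _ => halg x
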